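/- Let $k$ be a commutative ring with $1$ (for instance a field), and let $A$ be an associative $k$-algebra, not necessarily with identity, generated as an algebra by elements $a_1,\dots,a_l$ (together with the identity element, if $A$ has one). Suppose that $A$ satisfies an admissible polynomial identity of degree $n$, that is, there is a noncommutative polynomial $f$ over $k$ without constant term, all of whose terms have degree at most $n$ and in which some word of length $n$ has coefficient $1$, such that $f$ vanishes under all substitutions of elements of $A$ for its variables. For a set $Y$ of nonempty words in the generators, $A$ has bounded height $h=\mathrm{Ht}_Y(A)$ over $Y$ if $h$ is the least non-negative integer such that every nonempty word $x$ in the generators $a_1,\dots,a_l$ is equal in $A$ to a finite linear combination $$x=\sum_i \alpha_i\, u_{(i,1)}^{k_{(i,1)}}u_{(i,2)}^{k_{(i,2)}}\cdots u_{(i,r_i)}^{k_{(i,r_i)}},\qquad \alpha_i\in k,\ u_{(i,j)}\in Y,\ k_{(i,j)}\ge 1,\ 1\le r_i\le h$$ (the empty sum being $0$). Corollary (height of PI-algebras). Let $Y$ be the set of all nonempty words in $a_1,\dots,a_l$ of length less than $n$. Then $A$ has bounded height over $Y$, and $$\mathrm{Ht}_Y(A)\le \Phi(n,l),\qquad \Phi(n,l)=E_1\,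 l\, n^{E_2+12\log_3 n},\quad E_1=4^{21\log_3 4+17},\quad E_2=30\log_3 4+10 .$$ -/

import Mathlib

/-!
Associative algebras are not assumed to have an identity element. Nonempty words over an alphabet
`X` are elements of the free semigroup `FreeSemigroup X`, and noncommutative polynomials without
constant term, with coefficients in `k`, are elements of its semigroup algebra
`MonoidAlgebra k (FreeSemigroup X)`.
-/

namespace ShirshovHeight

/-- A nonempty word, viewed in the free monoid of all words. -/
def toWord {X : Type*} : FreeSemigroup X →ₙ* FreeMonoid X :=
  FreeSemigroup.lift FreeMonoid.of

/-- The value of a nonempty word when each letter `x` is replaced by the element `a x`. -/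
def evalWord {X A : Type*} [Semigroup A] (a : X → A) : FreeSemigroup X →ₙ* A :=
  FreeSemigroup.lift a

section Algebra

variable (k : Type*) [CommRing k] {A : Type*} [NonUnitalRing A] [Module k A]
  [IsScalarTower k A A] [SMulCommClass k A A]

/-- The value of a noncommutative polynomial (without constant term, in the variables
`x₀, x₁, …`) under the substitution `x_i ↦ s i`. -/
noncomputable def evalPoly (s : ℕ → A) : MonoidAlgebra k (FreeSemigroup ℕ) →ₙₐ[k] A :=
  MonoidAlgebra.liftMagma k (evalWord s)

/-- `f` is a polynomial identity of `A`: it vanishes under all substitutions from `A`. -/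
def IsPolynomialIdentity (A : Type*) [NonUnitalRing A] [Module k A]
    [IsScalarTower k A A] [SMulCommClass k A A]
    (f : MonoidAlgebra k (FreeSemigroup ℕ)) : Prop :=
  ∀ s : ℕ → A, evalPoly k s f = 0

/-- `f` is admissible of degree `n`: all its terms have degree at most `n`, and some term of
degree `n` has coefficient `1`. -/
def IsAdmissible (f : MonoidAlgebra k (FreeSemigroup ℕ)) (n : ℕ) : Prop :=
  (∀ w : FreeSemigroup ℕ, f.coeff w ≠ 0 → w.length ≤ n) ∧
    ∃ w : FreeSemigroup ℕ, w.length = n ∧ f.coeff w = 1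

/-- `A` is generated as an algebra by the elements `a x`, together with its identity element
if it has one. So for an algebra with identity this is generation as a unital algebra, and for an
algebra without identity it is generation as a non-unital algebra. -/
def Generates {X : Type*} (a : X → A) : Prop :=
  NonUnitalAlgebra.adjoin k (Set.range a ∪ {e : A | ∀ x : A, e * x = x ∧ x * e = x}) = ⊤

/-- The word `v` is a product `u₁ ^ k₁ * ⋯ * u_r ^ k_r` with `r ≤ h`, all `u_j ∈ Y` and all
`k_j ≥ 1`. -/
def IsProductOfPowers {X : Type*} (Y : Set (FreeSemigroup X)) (h : ℕ)
    (v : FreeSemigroup X) : Prop :=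
  ∃ p : List (FreeSemigroup X × ℕ), p.length ≤ h ∧ (∀ q ∈ p, q.1 ∈ Y ∧ 0 < q.2) ∧
    toWord v = (p.map fun q => toWord q.1 ^ q.2).prod

/-- Every word in the generators `a x` is, as an element of `A`, a linear combination of products
of at most `h` powers of words from `Y`. -/
def HeightAtMost {X : Type*} (a : X → A) (Y : Set (FreeSemigroup X)) (h : ℕ) : Prop :=
  ∀ w : FreeSemigroup X,
    evalWord a w ∈ Submodule.span k (evalWord a '' {v | IsProductOfPowers Y h v})

/-- `A`, with the generators `a x`, has bounded height, equal to `h`, over the set of words `Y`. -/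
def HasHeight {X : Type*} (a : X → A) (Y : Set (FreeSemigroup X)) (h : ℕ) : Prop :=
  IsLeast {m : ℕ | HeightAtMost k a Y m} h

end Algebra

/-- `Φ(n,l) = E₁ l n ^ (E₂ + 12 log₃ n)` with `E₁ = 4 ^ (21 log₃ 4 + 17)` and
`E₂ = 30 log₃ 4 + 10`. -/
noncomputable def Φ (n l : ℕ) : ℝ :=
  (4 : ℝ) ^ (21 * Real.logb 3 4 + 17) * (l : ℝ) *
    (n : ℝ) ^ ((30 * Real.logb 3 4 + 10) + 12 * Real.logb 3 (n : ℝ))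

end ShirshovHeight

/-! The argument joins Shirshov's reduction to a combinatorial bound for indivisible words.

Reduction: inclusion and exclusion turns the identity into a multilinear one in which `x₁ ⋯ xₙ` has
coefficient `1` (`exists_multilinear_identity`). A divisible word has the form `u v₁ ⋯ vₙ` with
strictly decreasing block beginnings, so every nontrivial permutation of the blocks makes it
lexicographically smaller. The identity rewrites it through smaller words of the same length, and
since these are finite in number only indivisible words remain (`evalList_mem_span_not_divisible`).

Combinatorics: call a factor of length `m = 2 ^ J` rich if its first `n` factors of length `2 * n`
are distinct. Where richness fails the word has a period below `n`; following the period until it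
breaks costs few powers and ends just before a rich factor (`exists_prefix`). Hence the height is
governed by the number of disjoint rich factors.

That number is bounded by `card_richWindows_lt`. In an indivisible word, factors at a fixed place of
successive windows have no decreasing subsequence of length `n`, so they split into `n - 1`
increasing sequences. On a long stretch each of these is constant, leaving at most `n - 1` values.
Doubling the factor length from `1` to `2 ^ J` reaches whole windows in `J` rounds, each losing a
factor polynomial in `n`; as `J` is about `log n`, the total is `n ^ O(log n)`. Finally `n` equal
rich windows would give `n` decreasing factors, one from each. -/

namespace ShirshovHeight

/-! ### Sequences of words without long decreasing subsequences. -/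

section Words

variable {α : Type*}

/-- The factor of length `r` of the word `w` starting at position `x` (truncated at the end). -/
def fac (w : List α) (x r : ℕ) : List α := (w.drop x).take r

theorem fac_length {w : List α} {x r : ℕ} (h : x + r ≤ w.length) : (fac w x r).length = r := by
  simp [fac]; omega

theorem fac_getElem? (w : List α) (x r i : ℕ) :
    (fac w x r)[i]? = if i < r then w[x + i]? else none := by
  simp [fac, List.getElem?_take]

theorem fac_add (w : List α) (x r s : ℕ) : fac w x (r + s) = fac w x r ++ fac w (x + r) s := by
  simp [fac, List.take_add, List.drop_drop]

theorem fac_fac {w : List α} {x m t r : ℕ} (h : t + r ≤ m) :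
    fac (fac w x m) t r = fac w (x + t) r := by
  apply List.ext_getElem?
  intro i
  simp only [fac_getElem?]
  split_ifs <;> first | omega | (congr 1; omega) | rfl

theorem fac_drop (w : List α) (x t r : ℕ) : fac (w.drop x) t r = fac w (x + t) r := by
  simp [fac, List.drop_drop]

/-- The word `w` has `n` disjoint factors of equal length, which strictly decrease from left to
right in the lexicographic order. -/
def Divisible [LT α] (n : ℕ) (w : List α) : Prop :=
  ∃ (r : ℕ) (x : ℕ → ℕ), (∀ i < n, x i + r ≤ w.length) ∧
    ∀ i j, i < j → j < n → x i + r ≤ x j ∧ fac w (x j) r < fac w (x i) r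

/-- The sequence `x 0, …, x (N - 1)` has a strictly decreasing subsequence of length `n`. -/
def HasDecreasing {β : Type*} [LT β] (n N : ℕ) (x : ℕ → β) : Prop :=
  ∃ s : ℕ → ℕ, (∀ i < n, s i < N) ∧ ∀ i j, i < j → j < n → s i < s j ∧ x (s j) < x (s i)

/-- A sequence without strictly decreasing subsequences of length `q + 1` is a union of `q` weakly
increasing ones. -/
theorem exists_coloring {β : Type*} [LinearOrder β] {q N : ℕ} (x : ℕ → β)
    (h : ¬ HasDecreasing (q + 1) N x) :
    ∃ c : ℕ → ℕ, (∀ i < N, c i < q) ∧ ∀ i j, i ≤ j → j < N → c i = c j → x i ≤ x j := by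
  classical
  -- `P i m`: some strictly decreasing chain of `m + 1` terms ends at `i`. The colour of `i` is the
  -- largest such `m`.
  let P : ℕ → ℕ → Prop := fun i m =>
    ∃ s : ℕ → ℕ, s m = i ∧ ∀ a b, a < b → b ≤ m → s a < s b ∧ x (s b) < x (s a)
  have hP0 : ∀ i, P i 0 := fun i => ⟨fun _ => i, rfl, fun a b hab hb => by omega⟩
  have hPq : ∀ i < N, ¬ P i q := by
    rintro i hi ⟨s, hsi, hs⟩
    refine h ⟨s, fun a ha => ?_, fun a b hab hb => hs a b hab (by omega)⟩
    rcases (Nat.lt_succ_iff.1 ha).lt_or_eq with h1 | rfl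
    · exact ((hs a q h1 le_rfl).1.trans_eq hsi).trans hi
    · omega
  have hlt : ∀ i < N, Nat.findGreatest (P i) q < q := fun i hi => by
    refine lt_of_le_of_ne (Nat.findGreatest_le q) fun h1 => hPq i hi ?_
    have := Nat.findGreatest_spec (P := P i) (Nat.zero_le q) (hP0 i)
    rwa [h1] at this
  refine ⟨fun i => Nat.findGreatest (P i) q, hlt, fun i j hij hj hc => ?_⟩
  by_contra! hx
  have hij' : i < j := lt_of_le_of_ne hij (by rintro rfl; exact lt_irrefl _ hx)
  obtain ⟨s, hsi, hs⟩ := Nat.findGreatest_spec (P := P i) (Nat.zero_le q) (hP0 i)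
  -- If `x j < x i`, a longest chain ending at `i` extends to `j`, so the colours differ.
  have h2 : P j (Nat.findGreatest (P i) q + 1) := by
    set m := Nat.findGreatest (P i) q
    refine ⟨fun a => if a ≤ m then s a else j, by simp, fun a b hab hb => ?_⟩
    have ha : a ≤ m := by omega
    by_cases hbm : b ≤ m
    · simpa [ha, hbm] using hs a b hab hbm
    · simp only [ha, hbm, if_true, if_false]
      rcases ha.lt_or_eq with h3 | rfl
      · have := hs a m h3 le_rfl
        rw [hsi] at this
        exact ⟨this.1.trans hij', hx.trans this.2⟩
      · rw [hsi]; exact ⟨hij', hx⟩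
  have h3 := Nat.le_findGreatest (hlt i (by omega)) h2
  simp only at hc
  omega

/-- Finitely many sequences without long strictly decreasing subsequences take few values on a
common long interval. -/
theorem exists_interval_card_image_le {ι β : Type*} [DecidableEq β] [LinearOrder β] {q N M s : ℕ} (T : Finset ι)
    (x : ι → ℕ → β) (V : ι → Finset β) (hV : ∀ t ∈ T, ∀ i < N, x t i ∈ V t)
    (hs : ∀ t ∈ T, (V t).card ≤ s) (hdec : ∀ t ∈ T, ¬ HasDecreasing (q + 1) N (x t))
    (hN : (T.card * (q * s) + 1) * M ≤ N) :
    ∃ a, a + M ≤ N ∧ ∀ t ∈ T, ((Finset.Ico a (a + M)).image (x t)).card ≤ q := by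
  classical
  have hcol : ∀ t, ∃ c : ℕ → ℕ, t ∈ T → (∀ i < N, c i < q) ∧
      ∀ i j, i ≤ j → j < N → c i = c j → x t i ≤ x t j := fun t => by
    by_cases ht : t ∈ T
    · obtain ⟨c, hc⟩ := exists_coloring (x t) (hdec t ht)
      exact ⟨c, fun _ => hc⟩
    · exact ⟨fun _ => 0, fun h => absurd h ht⟩
  choose c hc using hcol
  -- First occurrences of the pairs (colour, value), over all the sequences.
  let D : Finset ℕ := T.biUnion fun t =>
    (Finset.range N).filter fun i => ∀ j < i, ¬ (c t j = c t i ∧ x t j = x t i)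
  have hD : D.card ≤ T.card * (q * s) := by
    refine Finset.card_biUnion_le_card_mul _ _ _ fun t ht => ?_
    calc _ ≤ (Finset.range q ×ˢ V t).card := by
          refine Finset.card_le_card_of_injOn (fun i => (c t i, x t i)) ?_ ?_
          · intro i hi
            simp only [Finset.coe_filter, Finset.mem_range, Set.mem_ofPred_eq] at hi
            simp [(hc t ht).1 i hi.1, hV t ht i hi.1]
          · intro i hi j hj hij
            simp only [Finset.coe_filter, Finset.mem_range, Set.mem_ofPred_eq] at hi hj
            simp only [Prod.mk.injEq] at hij
            rcases lt_trichotomy i j with h1 | h1 | h1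
            · exact absurd hij (hj.2 i h1)
            · exact h1
            · exact absurd ⟨hij.1.symm, hij.2.symm⟩ (hi.2 j h1)
      _ ≤ q * s := by
          rw [Finset.card_product, Finset.card_range]
          exact Nat.mul_le_mul_left _ (hs t ht)
  -- There are more blocks of length `M` than elements of `D`, so some block contains no first
  -- occurrence.
  obtain ⟨b, hb, hbD⟩ : ∃ b ≤ T.card * (q * s), ∀ i ∈ D, ¬ (b * M ≤ i ∧ i < b * M + M) := by
    by_contra! hcon
    choose! d hdD hd1 hd2 using hcon
    have : (Finset.range (T.card * (q * s) + 1)).card ≤ D.card := by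
      refine Finset.card_le_card_of_injOn d (fun b hb => ?_) fun b hb b' hb' h => ?_
      · exact hdD b (by simpa [Nat.lt_succ_iff] using hb)
      · have key : ∀ b ≤ T.card * (q * s), d b / M = b := fun b hb => by
          have h1 := hd1 b hb
          have h2 := hd2 b hb
          exact Nat.div_eq_of_lt_le h1 (by rw [Nat.succ_mul]; exact h2)
        rw [← key b (by simpa [Nat.lt_succ_iff] using hb),
          ← key b' (by simpa [Nat.lt_succ_iff] using hb'), h]
    rw [Finset.card_range] at this
    omega
  have hbN : b * M + M ≤ N := by
    calc b * M + M = (b + 1) * M := by ring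
      _ ≤ _ := Nat.mul_le_mul_right _ (by omega)
      _ ≤ N := hN
  refine ⟨b * M, hbN, fun t ht => ?_⟩
  have key : ∀ i ∈ Finset.Ico (b * M) (b * M + M), ∀ j ∈ Finset.Ico (b * M) (b * M + M),
      i ≤ j → c t i = c t j → x t i = x t j := by
    intro i hi j hj hij hcij
    rw [Finset.mem_Ico] at hi hj
    have hex : ∃ j', c t j' = c t j ∧ x t j' = x t j := ⟨j, rfl, rfl⟩
    have hspec := Nat.find_spec hex
    have hle : Nat.find hex ≤ j := Nat.find_min' hex ⟨rfl, rfl⟩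
    have hmem : Nat.find hex ∈ D := by
      refine Finset.mem_biUnion.2 ⟨t, ht, Finset.mem_filter.2 ⟨Finset.mem_range.2 (by omega), fun j' hj' => ?_⟩⟩
      rw [hspec.1, hspec.2]
      exact Nat.find_min hex hj'
    have hlt : Nat.find hex < i := by
      by_contra! hge
      exact hbD _ hmem ⟨by omega, by omega⟩
    -- The value `x t j` already occurred in the same colour before `i`; monotonicity within the
    -- colour squeezes `x t i` onto it.
    refine le_antisymm ((hc t ht).2 i j hij (by omega) hcij) ?_
    rw [← hspec.2]
    exact (hc t ht).2 _ i hlt.le (by omega) (hspec.1.trans hcij.symm)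
  have key' : ∀ i ∈ Finset.Ico (b * M) (b * M + M), ∀ j ∈ Finset.Ico (b * M) (b * M + M),
      c t i = c t j → x t i = x t j := by
    intro i hi j hj h
    rcases le_total i j with h1 | h1
    · exact key i hi j hj h1 h
    · exact (key j hj i hi h1 h.symm).symm
  have hcard : ((Finset.Ico (b * M) (b * M + M)).image (x t)).card ≤ (Finset.range q).card := by
    have hinv : ∀ v ∈ (Finset.Ico (b * M) (b * M + M)).image (x t),
        ∃ i ∈ Finset.Ico (b * M) (b * M + M), x t i = v := fun v hv => Finset.mem_image.1 hv
    choose! g hg1 hg2 using hinv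
    refine Finset.card_le_card_of_injOn (fun v => c t (g v)) (fun v hv => ?_)
      fun v hv w hw h => ?_
    · have := Finset.mem_Ico.1 (hg1 v hv)
      simpa using (hc t ht).1 (g v) (by omega)
    · rw [← hg2 v hv, ← hg2 w hw]
      exact key' _ (hg1 v hv) _ (hg1 w hw) h
  simpa using hcard

theorem HasDecreasing.shift {β : Type*} [LT β] {n N M a : ℕ} {x : ℕ → β}
    (h : HasDecreasing n M fun i => x (a + i)) (hN : a + M ≤ N) : HasDecreasing n N x := by
  obtain ⟨s, hs, hs'⟩ := h
  refine ⟨fun i => a + s i, fun i hi => ?_, fun i j hij hj => ⟨?_, (hs' i j hij hj).2⟩⟩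
  · have := hs i hi; dsimp only; omega
  · have := (hs' i j hij hj).1; dsimp only; omega

/-- A sequence of words of length `2 ^ J`, in which equally placed factors never form long strictly
decreasing subsequences, has a long interval on which aligned factors of length `2 ^ j` take few
values. -/
theorem exists_interval_factors [LinearOrder α] [Fintype α] {q N J : ℕ}
    (hα : 0 < Fintype.card α) (u : ℕ → List α) (hu : ∀ i < N, (u i).length = 2 ^ J)
    (hdec : ∀ t r, t + r ≤ 2 ^ J → ¬ HasDecreasing (q + 1) N fun i => fac (u i) t r) :
    ∀ j ≤ J, ∀ M, 2 ^ J * (q + 1) * Fintype.card α * (2 ^ J * (q + 1) ^ 3) ^ j * M ≤ N →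
      ∃ a, a + M ≤ N ∧ ∀ t < 2 ^ (J - j),
        ((Finset.Ico a (a + M)).image fun i => fac (u i) (t * 2 ^ j) (2 ^ j)).card ≤ q := by
  intro j
  induction j with
  | zero =>
    intro _ M hM
    have hV : ∀ t ∈ Finset.range (2 ^ J), ∀ i < N,
        fac (u i) t 1 ∈ Finset.univ.image fun y : α => [y] := by
      intro t ht i hi
      have hlen : (fac (u i) t 1).length = 1 := fac_length (by
        rw [hu i hi]; simpa using ht)
      obtain ⟨y, hy⟩ := List.length_eq_one_iff.1 hlen
      simp only [Finset.mem_image, Finset.mem_univ, true_and]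
      exact ⟨y, hy.symm⟩
    have hM' : ((Finset.range (2 ^ J)).card * (q * Fintype.card α) + 1) * M ≤ N := by
      refine le_trans (Nat.mul_le_mul_right M ?_) hM
      have : 1 ≤ 2 ^ J * Fintype.card α := Nat.one_le_iff_ne_zero.2 (by positivity)
      simp only [Finset.card_range, pow_zero, mul_one]
      nlinarith
    obtain ⟨a, ha, h⟩ := exists_interval_card_image_le (Finset.range (2 ^ J))
      (fun t i => fac (u i) t 1) _ hV (fun t _ => Finset.card_image_le)
      (fun t ht => hdec t 1 (by simpa using ht)) hM'
    refine ⟨a, ha, fun t ht => ?_⟩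
    simpa using h t (by simpa using ht)
  | succ j ih =>
    intro hj M hM
    -- Two adjacent factors with at most `q` values each allow `q * q` concatenations, so this round
    -- costs at most `2 ^ J * (q + 1) ^ 3`.
    obtain ⟨a, ha, h⟩ := ih (by omega) (2 ^ J * (q + 1) ^ 3 * M) (by
      rw [pow_succ] at hM
      exact (le_of_eq (by ring)).trans hM)
    have hJ : 2 ^ (J - j) = 2 ^ (J - (j + 1)) * 2 := by
      rw [← pow_succ]; congr 1; omega
    have hJ' : 2 ^ J = 2 ^ (J - (j + 1)) * 2 ^ (j + 1) := by
      rw [← pow_add]; congr 1; omega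
    let V : ℕ → Finset (List α) := fun t =>
      (Finset.Ico a (a + 2 ^ J * (q + 1) ^ 3 * M)).image fun i => fac (u i) (t * 2 ^ j) (2 ^ j)
    have hV : ∀ t ∈ Finset.range (2 ^ (J - (j + 1))), ∀ i < 2 ^ J * (q + 1) ^ 3 * M,
        fac (u (a + i)) (t * 2 ^ (j + 1)) (2 ^ (j + 1)) ∈
          (V (2 * t) ×ˢ V (2 * t + 1)).image fun p => p.1 ++ p.2 := by
      intro t ht i hi
      refine Finset.mem_image.2 ⟨(fac (u (a + i)) (2 * t * 2 ^ j) (2 ^ j),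
        fac (u (a + i)) ((2 * t + 1) * 2 ^ j) (2 ^ j)), ?_, ?_⟩
      · refine Finset.mem_product.2 ⟨Finset.mem_image.2 ⟨a + i, ?_, rfl⟩,
          Finset.mem_image.2 ⟨a + i, ?_, rfl⟩⟩ <;> (rw [Finset.mem_Ico]; omega)
      · simp only
        rw [show t * 2 ^ (j + 1) = 2 * t * 2 ^ j by ring, show 2 ^ (j + 1) = 2 ^ j + 2 ^ j by ring,
          fac_add, show 2 * t * 2 ^ j + 2 ^ j = (2 * t + 1) * 2 ^ j by ring]
    have hs : ∀ t ∈ Finset.range (2 ^ (J - (j + 1))),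
        ((V (2 * t) ×ˢ V (2 * t + 1)).image fun p => p.1 ++ p.2).card ≤ q * q := by
      intro t ht
      rw [Finset.mem_range] at ht
      refine Finset.card_image_le.trans ?_
      rw [Finset.card_product]
      exact Nat.mul_le_mul (h _ (by omega)) (h _ (by omega))
    have hd : ∀ t ∈ Finset.range (2 ^ (J - (j + 1))), ¬ HasDecreasing (q + 1)
        (2 ^ J * (q + 1) ^ 3 * M) fun i => fac (u (a + i)) (t * 2 ^ (j + 1)) (2 ^ (j + 1)) := by
      intro t ht hd
      rw [Finset.mem_range] at ht
      refine hdec (t * 2 ^ (j + 1)) (2 ^ (j + 1)) ?_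
        (hd.shift (x := fun i => fac (u i) (t * 2 ^ (j + 1)) (2 ^ (j + 1))) ha)
      rw [hJ']
      calc _ = (t + 1) * 2 ^ (j + 1) := by ring
        _ ≤ _ := Nat.mul_le_mul_right _ ht
    have hM' : ((Finset.range (2 ^ (J - (j + 1)))).card * (q * (q * q)) + 1) * M ≤
        2 ^ J * (q + 1) ^ 3 * M := by
      refine Nat.mul_le_mul_right M ?_
      rw [Finset.card_range]
      have h1 : 2 ^ (J - (j + 1)) ≤ 2 ^ J := Nat.pow_le_pow_right (by norm_num) (by omega)
      have h2 : 1 ≤ 2 ^ J := Nat.one_le_two_pow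
      have h3 : 2 ^ (J - (j + 1)) * (q * (q * q)) ≤ 2 ^ J * (q * (q * q)) :=
        Nat.mul_le_mul_right _ h1
      nlinarith [Nat.zero_le (2 ^ J * q), Nat.zero_le (2 ^ J * q ^ 2)]
    obtain ⟨b, hb, h'⟩ := exists_interval_card_image_le (Finset.range (2 ^ (J - (j + 1))))
      (fun t i => fac (u (a + i)) (t * 2 ^ (j + 1)) (2 ^ (j + 1))) _ hV hs hd hM'
    refine ⟨a + b, by omega, fun t ht => (Finset.card_le_card fun v hv => ?_).trans
      (h' t (by simpa using ht))⟩
    obtain ⟨i, hi, rfl⟩ := Finset.mem_image.1 hv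
    rw [Finset.mem_Ico] at hi
    refine Finset.mem_image.2 ⟨i - a, by rw [Finset.mem_Ico]; omega, ?_⟩
    rw [show a + (i - a) = i by omega]

end Words
-- Rich windows and products of powers of short words.
section Windows

variable {α : Type*}

/-- The factors of length `2 * n` starting at the first `n` positions are pairwise distinct. -/
def Rich (n : ℕ) (w : List α) : Prop :=
  ∀ i j, i < j → j < n → fac w i (2 * n) ≠ fac w j (2 * n)

/-- The positions `p 0, …, p (N - 1)` start disjoint rich factors of length `m` of `w`. -/
def RichWindows (n m N : ℕ) (p : ℕ → ℕ) (w : List α) : Prop :=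
  (∀ i < N, p i + m ≤ w.length ∧ Rich n (fac w (p i) m)) ∧
    ∀ i j, i < j → j < N → p i + m ≤ p j

/-- Sorts the `n` distinct factors. The offsets need not be monotone and the factors may overlap:
each will be taken from a different window. -/
theorem exists_decreasing_offsets [LinearOrder α] {n : ℕ} {w : List α} (h : Rich n w) :
    ∃ o : ℕ → ℕ, (∀ i < n, o i < n) ∧
      ∀ i j, i < j → j < n → fac w (o j) (2 * n) < fac w (o i) (2 * n) := by
  let s : Finset (List α) := (Finset.range n).image fun i => fac w i (2 * n)
  have hs : s.card = n := by
    rw [Finset.card_image_of_injOn, Finset.card_range]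
    intro i hi j hj hij
    rw [Finset.coe_range, Set.mem_Iio] at hi hj
    rcases lt_trichotomy i j with h1 | h1 | h1
    · exact absurd hij (h i j h1 hj)
    · exact h1
    · exact absurd hij.symm (h j i h1 hi)
  have hmem : ∀ i : Fin n, ∃ j < n, fac w j (2 * n) = s.orderEmbOfFin hs i.rev := fun i => by
    obtain ⟨j, hj, hj'⟩ := Finset.mem_image.1 (Finset.orderEmbOfFin_mem s hs i.rev)
    exact ⟨j, Finset.mem_range.1 hj, hj'⟩
  choose o ho ho' using hmem
  refine ⟨fun i => if h : i < n then o ⟨i, h⟩ else 0, fun i hi => by simp [hi, ho],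
    fun i j hij hj => ?_⟩
  have hi : i < n := hij.trans hj
  simp only [hi, hj, dif_pos, ho']
  exact (s.orderEmbOfFin hs).strictMono (Fin.rev_lt_rev.2 hij)

/-- Factors lying inside disjoint windows are themselves disjoint. -/
theorem divisible_of_hasDecreasing [LT α] {n m N t r : ℕ} {p : ℕ → ℕ} {w : List α}
    (hw : RichWindows n m N p w) (htr : t + r ≤ m)
    (h : HasDecreasing n N fun i => fac (fac w (p i) m) t r) : Divisible n w := by
  obtain ⟨s, hs, hs'⟩ := h
  refine ⟨r, fun i => p (s i) + t, fun i hi => ?_, fun i j hij hj => ?_⟩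
  · have := (hw.1 (s i) (hs i hi)).1
    dsimp only; omega
  · obtain ⟨h1, h2⟩ := hs' i j hij hj
    have := hw.2 (s i) (s j) h1 (hs j hj)
    simp only [fac_fac htr] at h2
    exact ⟨by dsimp only; omega, h2⟩

/-- A word without long decreasing families of factors contains few disjoint rich factors. -/
theorem card_richWindows_lt [LinearOrder α] [Fintype α] {q J N : ℕ} {p : ℕ → ℕ} {w : List α}
    (hα : 0 < Fintype.card α) (hJ : 3 * (q + 1) ≤ 2 ^ J) (hdiv : ¬ Divisible (q + 1) w)
    (hw : RichWindows (q + 1) (2 ^ J) N p w) :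
    N < 2 ^ J * (q + 1) * Fintype.card α * (2 ^ J * (q + 1) ^ 3) ^ J * (q + 1) ^ 2 := by
  by_contra! hN
  obtain ⟨a, ha, h⟩ := exists_interval_factors hα (fun i => fac w (p i) (2 ^ J))
    (fun i hi => fac_length (hw.1 i hi).1)
    (fun t r htr hd => hdiv (divisible_of_hasDecreasing hw htr hd)) J le_rfl _ hN
  have h0 := h 0 (by simp)
  simp only [zero_mul, fac_fac (show 0 + 2 ^ J ≤ 2 ^ J by simp), add_zero] at h0
  -- Among `(q + 1) ^ 2` windows with at most `q` values, some `q + 1` windows coincide.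
  obtain ⟨v, hv, hcard⟩ := Finset.exists_lt_card_fiber_of_mul_lt_card_of_maps_to (n := q)
    (fun i hi => Finset.mem_image_of_mem (fun i => fac w (p i) (2 ^ J)) hi) (by
      have : (Finset.Ico a (a + (q + 1) ^ 2)).card = (q + 1) ^ 2 := by simp
      rw [this]
      nlinarith)
  set S := {x ∈ Finset.Ico a (a + (q + 1) ^ 2) | fac w (p x) (2 ^ J) = v}
  let e : Fin (q + 1) ↪o ℕ := S.orderEmbOfCardLe hcard
  have he : ∀ i, e i < N ∧ fac w (p (e i)) (2 ^ J) = v := fun i => by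
    have := Finset.orderEmbOfCardLe_mem S hcard i
    obtain ⟨h1, h2⟩ := Finset.mem_filter.1 this
    exact ⟨(Finset.mem_Ico.1 h1).2.trans_le ha, h2⟩
  have hrich : Rich (q + 1) v := by
    rw [← (he 0).2]; exact (hw.1 _ (he 0).1).2
  obtain ⟨o, ho, ho'⟩ := exists_decreasing_offsets hrich
  have hfac : ∀ i, ∀ t < q + 1,
      fac w (p (e i) + t) (2 * (q + 1)) = fac v t (2 * (q + 1)) := fun i t ht => by
    rw [← (he i).2, fac_fac (by omega)]
  -- From the `i`-th copy of `v` take its `i`-th largest factor.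
  refine hdiv ⟨2 * (q + 1), fun i => if h : i < q + 1 then p (e ⟨i, h⟩) + o i else 0,
    fun i hi => ?_, fun i j hij hj => ?_⟩
  · have h1 := (hw.1 _ (he ⟨i, hi⟩).1).1
    have h2 := ho i hi
    simp only [hi, dif_pos]
    omega
  · have hi : i < q + 1 := hij.trans hj
    have h1 := hw.2 _ _ (e.strictMono (show (⟨i, hi⟩ : Fin (q + 1)) < ⟨j, hj⟩ from hij)) (he _).1
    have h2 := ho i hi
    simp only [hi, hj, dif_pos, hfac _ _ h2, hfac _ _ (ho j hj)]
    exact ⟨by omega, ho' i j hij hj⟩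

/-- The word `w` is a product of at most `h` powers of nonempty words of length less than `n`. -/
def IsProductOfShortPowers (n h : ℕ) (w : List α) : Prop :=
  ∃ ps : List (List α × ℕ), ps.length ≤ h ∧
    (∀ q ∈ ps, q.1 ≠ [] ∧ q.1.length < n ∧ 0 < q.2) ∧
    w = (ps.map fun q => (List.replicate q.2 q.1).flatten).flatten

namespace IsProductOfShortPowers

theorem mono {n h h' : ℕ} {w : List α} (hw : IsProductOfShortPowers n h w) (hh : h ≤ h') :
    IsProductOfShortPowers n h' w := by
  obtain ⟨ps, h1, h2⟩ := hw
  exact ⟨ps, h1.trans hh, h2⟩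

theorem append {n h h' : ℕ} {v w : List α} (hv : IsProductOfShortPowers n h v)
    (hw : IsProductOfShortPowers n h' w) : IsProductOfShortPowers n (h + h') (v ++ w) := by
  obtain ⟨ps, h1, h2, rfl⟩ := hv
  obtain ⟨qs, h3, h4, rfl⟩ := hw
  refine ⟨ps ++ qs, by simp; omega, fun q hq => ?_, by simp⟩
  rcases List.mem_append.1 hq with h | h
  exacts [h2 q h, h4 q h]

theorem nil {n h : ℕ} : IsProductOfShortPowers n h ([] : List α) :=
  ⟨[], by simp, by simp, by simp⟩

theorem of_length_le {n h : ℕ} (hn : 2 ≤ n) {w : List α} (hw : w.length ≤ h) :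
    IsProductOfShortPowers n h w := by
  refine ⟨w.map fun y => ([y], 1), by simpa using hw, ?_, ?_⟩
  · simp only [List.mem_map]
    rintro _ ⟨y, -, rfl⟩
    exact ⟨by simp, by simp; omega, by simp⟩
  · simp [Function.comp_def, ← List.flatMap_def]

theorem pow {n : ℕ} {w : List α} (hw : w.length < n) (k : ℕ) :
    IsProductOfShortPowers n 1 (List.replicate k w).flatten := by
  rcases eq_or_ne w [] with rfl | hw'
  · simpa using nil
  rcases Nat.eq_zero_or_pos k with rfl | hk
  · simpa using nil
  · exact ⟨[(w, k)], by simp, by simp [hw', hw, hk], by simp⟩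

end IsProductOfShortPowers

theorem fac_eq_flatten_replicate {w : List α} {p : ℕ} (k s : ℕ) (hlen : s + k * p ≤ w.length)
    (hper : ∀ y, s ≤ y → y + p < s + k * p → w[y]? = w[y + p]?) :
    fac w s (k * p) = (List.replicate k (fac w s p)).flatten := by
  induction k generalizing s with
  | zero => simp [fac]
  | succ k ih =>
    rcases k with _ | k
    · simp
    rw [show (k + 1 + 1) * p = p + (k + 1) * p by ring, fac_add, List.replicate_succ,
      List.flatten_cons]
    rw [show (k + 1 + 1) * p = p + (k + 1) * p by ring] at hlen hper
    congr 1
    rw [ih (s + p) (by omega) fun y hy hy' => hper y (by omega) (by omega)]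
    congr 2
    apply List.ext_getElem?
    intro i
    rw [fac_getElem?, fac_getElem?]
    split_ifs with hi
    · rw [show s + p + i = s + i + p by ring]
      refine (hper _ (by omega) ?_).symm
      have : p ≤ (k + 1) * p := Nat.le_mul_of_pos_left p (by omega)
      omega
    · rfl

theorem take_eq_append_fac (w : List α) {s e : ℕ} (h : s ≤ e) :
    w.take e = w.take s ++ fac w s (e - s) := by
  rw [fac, ← List.take_add]
  congr 1; omega

/-- The full periods form one power; the incomplete last one is spelled out letter by letter. -/
theorem isProductOfShortPowers_fac_of_periodic {n p s e : ℕ} (hn : 2 ≤ n) {w : List α}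
    (hp : 0 < p) (hpn : p < n) (he : e ≤ w.length) (hse : s ≤ e)
    (hper : ∀ y, s ≤ y → y + p < e → w[y]? = w[y + p]?) :
    IsProductOfShortPowers n (1 + n) (fac w s (e - s)) := by
  have hdm := Nat.div_add_mod' (e - s) p
  have hlt := Nat.mod_lt (e - s) hp
  rw [← hdm, fac_add, fac_eq_flatten_replicate _ _ (by omega)
    fun y hy hy' => hper y hy (by omega)]
  refine .append (.pow ?_ _) (.of_length_le hn ?_)
  · simp [fac]; omega
  · simp [fac]; omega

/-- Every sufficiently long word starts with a product of few powers of short words, which is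
followed by a rich factor or stops near the end of the word. -/
theorem exists_prefix {n m : ℕ} (hn : 2 ≤ n) (hm : 3 * n ≤ m) (w : List α) (hw : m ≤ w.length) :
    ∃ e ≤ w.length, IsProductOfShortPowers n (2 * n + 1) (w.take e) ∧
      (e + m ≤ w.length → Rich n (fac w e m)) := by
  by_cases hR : Rich n w
  · refine ⟨0, Nat.zero_le _, by simpa using .nil, fun _ i j hij hj => ?_⟩
    rw [fac_fac (by omega), fac_fac (by omega), zero_add, zero_add]
    exact hR i j hij hj
  simp only [Rich, not_forall, not_not] at hR
  obtain ⟨s, s', hss, hs', heq⟩ := hR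
  obtain ⟨p, rfl⟩ : ∃ p, s' = s + p := ⟨s' - s, by omega⟩
  have hp : 0 < p := by omega
  have hper : ∀ i < 2 * n, w[s + i]? = w[s + i + p]? := fun i hi => by
    have := congrArg (fun l => l[i]?) heq
    simpa [fac_getElem?, hi, add_right_comm] using this
  have hex : ∃ x, s ≤ x ∧ w[x]? ≠ w[x + p]? := by
    refine ⟨w.length - p, by omega, ?_⟩
    rw [Nat.sub_add_cancel (by omega), List.getElem?_eq_getElem (by omega)]
    simp
  classical
  -- The first place where the period `p` breaks.
  set x := Nat.find hex with hx
  obtain ⟨hsx, hxne⟩ := Nat.find_spec hex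
  rw [← hx] at hsx hxne
  have hmin : ∀ y, s ≤ y → y < x → w[y]? = w[y + p]? := fun y hy hyx => by
    by_contra hne
    exact Nat.find_min hex hyx ⟨hy, hne⟩
  have hsx' : s + 2 * n ≤ x := by
    by_contra! hlt
    apply hxne
    have := hper (x - s) (by omega)
    rwa [Nat.add_sub_cancel' hsx] at this
  have hxl : x < w.length := by
    by_contra! hge
    apply hxne
    rw [List.getElem?_eq_none hge, List.getElem?_eq_none (by omega)]
  -- Stopping `n - 1` letters early puts the break inside each of the first `n` factors of length `2
  -- * n`.
  refine ⟨x - (n - 1), by omega, ?_, fun he i j hij hj hE => hxne ?_⟩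
  · rw [take_eq_append_fac w (show s ≤ x - (n - 1) by omega),
      show 2 * n + 1 = n + (1 + n) by ring]
    refine .append (.of_length_le hn (by simp; omega)) ?_
    exact isProductOfShortPowers_fac_of_periodic hn hp (by omega) (by omega) (by omega)
      fun y hy hy' => hmin y hy (by omega)
  -- Equal factors at `i < j` would give `w[x] = w[x - d]` and `w[x + p] = w[x + p - d]` for `d = j
  -- - i`. Period `p` still holds at `x - d`, so it would hold at `x` too.
  · rw [fac_fac (by omega), fac_fac (by omega)] at hE
    have h1 := congrArg (fun l => l[n - 1 - j]?) hE
    have h2 := congrArg (fun l => l[n - 1 - j + p]?) hE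
    simp only [fac_getElem?, if_pos (show n - 1 - j < 2 * n by omega),
      if_pos (show n - 1 - j + p < 2 * n by omega)] at h1 h2
    rw [show x - (n - 1) + j + (n - 1 - j) = x by omega] at h1
    rw [show x - (n - 1) + j + (n - 1 - j + p) = x + p by omega] at h2
    rw [← h1, ← h2, ← add_assoc]
    exact hmin _ (by omega) (by omega)

/-- Every word is a product of powers of short words, whose number is controlled by the number of
disjoint rich factors of the word. -/
theorem exists_richWindows {n m : ℕ} (hn : 2 ≤ n) (hm : 3 * n ≤ m) (w : List α) :
    ∃ N p, RichWindows n m N p w ∧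
      IsProductOfShortPowers n ((2 * n + 1 + m) * (N + 1)) w := by
  induction hL : w.length using Nat.strong_induction_on generalizing w with
  | _ L ih =>
    subst hL
    have hzero : RichWindows n m 0 (fun _ => 0) w :=
      ⟨fun i hi => absurd hi (Nat.not_lt_zero i), fun i j _ hj => absurd hj (Nat.not_lt_zero j)⟩
    rcases lt_or_ge w.length m with hlt | hge
    · exact ⟨0, fun _ => 0, hzero, .of_length_le hn (by omega)⟩
    obtain ⟨e, he, hpow, hrich⟩ := exists_prefix hn hm w hge
    rcases lt_or_ge w.length (e + m) with hlt | hge'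
    · refine ⟨0, fun _ => 0, hzero, ?_⟩
      rw [← List.take_append_drop e w, zero_add, mul_one]
      exact hpow.append (.of_length_le hn (by simp; omega))
    obtain ⟨N, p, hp, hP⟩ := ih (w.drop (e + m)).length (by simp; omega) _ rfl
    -- The window at `e` comes first, then those of the remainder, shifted. The window itself is
    -- written as `m` single letters.
    refine ⟨N + 1, fun i => if i = 0 then e else e + m + p (i - 1), ⟨fun i hi => ?_, ?_⟩, ?_⟩
    · rcases i with _ | i
      · simpa using ⟨hge', hrich hge'⟩
      · have := hp.1 i (by omega)
        rw [fac_drop, List.length_drop] at this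
        simp only [Nat.add_one_ne_zero, if_false, Nat.add_sub_cancel]
        exact ⟨by omega, this.2⟩
    · rintro i j hij hj
      obtain ⟨j, rfl⟩ := Nat.exists_eq_add_one_of_ne_zero (show j ≠ 0 by omega)
      rcases i with _ | i
      · simp
      · have := hp.2 i j (by omega) (by omega)
        simp only [Nat.add_one_ne_zero, if_false, Nat.add_sub_cancel]
        omega
    · rw [← List.take_append_drop (e + m) w, List.take_add,
        show (2 * n + 1 + m) * (N + 1 + 1) =
          2 * n + 1 + m + (2 * n + 1 + m) * (N + 1) by ring]
      exact (hpow.append (.of_length_le hn (by simp))).append hP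

/-- A word without long decreasing families of factors is a product of few powers of short
words. -/
theorem isProductOfShortPowers_of_not_divisible [LinearOrder α] [Fintype α] {n J : ℕ}
    (hα : 0 < Fintype.card α) (hn : 2 ≤ n) (hJ : 3 * n ≤ 2 ^ J) {w : List α}
    (hw : ¬ Divisible n w) :
    IsProductOfShortPowers n ((2 * n + 1 + 2 ^ J) *
      (2 ^ J * n * Fintype.card α * (2 ^ J * n ^ 3) ^ J * n ^ 2)) w := by
  obtain ⟨q, rfl⟩ : ∃ q, n = q + 1 := ⟨n - 1, by omega⟩
  obtain ⟨N, p, hp, hP⟩ := exists_richWindows hn hJ w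
  exact hP.mono (Nat.mul_le_mul_left _ (card_richWindows_lt hα hJ hw hp))

end Windows
-- Words as lists of letters.
section Letters

variable {X : Type*}

/-- The list of letters of a nonempty word. -/
def letters (w : FreeSemigroup X) : List X := w.head :: w.tail

theorem letters_mul (v w : FreeSemigroup X) : letters (v * w) = letters v ++ letters w := rfl

theorem letters_injective : Function.Injective (letters (X := X)) := fun v w h => by
  simp only [letters, List.cons.injEq] at h
  exact FreeSemigroup.ext h.1 h.2

theorem length_letters (w : FreeSemigroup X) : (letters w).length = w.length := rfl

theorem letters_ne_nil (w : FreeSemigroup X) : letters w ≠ [] := List.cons_ne_nil _ _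

theorem exists_letters_eq {w : List X} (hw : w ≠ []) : ∃ v : FreeSemigroup X, letters v = w := by
  obtain ⟨x, t, rfl⟩ := List.exists_cons_of_ne_nil hw
  exact ⟨⟨x, t⟩, rfl⟩

theorem toList_toWord (w : FreeSemigroup X) : FreeMonoid.toList (toWord w) = letters w := by
  induction w using FreeSemigroup.recOnMul with
  | ih1 x => rfl
  | ih2 x y hx hy => rw [map_mul, FreeMonoid.toList_mul, hx, hy, letters_mul]

variable {k A : Type*} [CommRing k] [NonUnitalRing A] [Module k A]

/-- The unitization gives empty products a meaning; injectivity of `inr` later brings results back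
to `A`. -/
theorem inr_evalWord [IsScalarTower k A A] [SMulCommClass k A A] (s : X → A)
    (w : FreeSemigroup X) :
    (Unitization.inr (evalWord s w) : Unitization k A) =
      ((letters w).map fun x => (Unitization.inr (s x) : Unitization k A)).prod := by
  induction w using FreeSemigroup.recOnMul with
  | ih1 x => simp [evalWord, letters]
  | ih2 x y hx hy =>
    rw [map_mul, Unitization.inr_mul, hx, hy, letters_mul, List.map_append, List.prod_append]

end Letters

/-! ### Multilinear parts by inclusion and exclusion. -/

section Linearization

variable {R : Type*} [Ring R]

/-- Expands the product over `i` of `1 + ε i`, where `ε i` is `-1` off the range of `g` and `0` on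
it; each missed `i` gives a zero factor. -/
theorem sum_neg_one_pow_card_compl {ι : Type*} [Fintype ι] [DecidableEq ι] {m : ℕ}
    (g : Fin m → ι) [Decidable (Function.Surjective g)] :
    ∑ S : Finset ι, (-1 : ℤ) ^ (Sᶜ).card * (if ∀ t, g t ∈ S then 1 else 0) =
      if Function.Surjective g then 1 else 0 := by
  classical
  have h := Finset.prod_add (fun _ => (1 : ℤ))
    (fun i : ι => if i ∉ Set.range g then (-1 : ℤ) else 0) Finset.univ
  have h1 : ∀ i : ι, (1 : ℤ) + (if i ∉ Set.range g then (-1 : ℤ) else 0) =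
      if i ∈ Set.range g then 1 else 0 := fun i => by
    by_cases hi : i ∈ Set.range g <;> simp [hi]
  simp only [h1, Finset.prod_ite_zero, Finset.prod_const_one, one_mul, Finset.powerset_univ,
    Finset.prod_const] at h
  have h2 : (∀ i ∈ Finset.univ, i ∈ Set.range g) ↔ Function.Surjective g := by
    simp [Function.Surjective]
  simp only [h2] at h
  rw [h]
  refine Finset.sum_congr rfl fun S _ => ?_
  rw [← Finset.compl_eq_univ_sdiff]
  have h3 : (∀ t, g t ∈ S) ↔ ∀ i ∈ Sᶜ, i ∉ Set.range g := by
    constructor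
    · rintro h i hi ⟨t, rfl⟩
      exact Finset.mem_compl.1 hi (h t)
    · intro h t
      by_contra hne
      exact h _ (Finset.mem_compl.2 hne) ⟨t, rfl⟩
  simp only [h3, mul_ite, mul_one, mul_zero]

theorem prod_map_sum (v : List ℕ) {n : ℕ} (w : Fin n → ℕ) (B : Fin n → R) (S : Finset (Fin n)) :
    (v.map fun x => ∑ j ∈ S with w j = x, B j).prod =
      ∑ g : Fin v.length → Fin n, if ∀ t, w (g t) = v[t] then
        (if ∀ t, g t ∈ S then (1 : ℤ) else 0) • (List.ofFn fun t => B (g t)).prod else 0 := by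
  classical
  have h := (MultilinearMap.mkPiAlgebraFin ℤ v.length R).map_sum_finset
    (fun (_ : Fin v.length) (j : Fin n) => B j) (fun t => S.filter fun j => w j = v[t])
  simp only [MultilinearMap.mkPiAlgebraFin_apply] at h
  rw [show v.map (fun x => ∑ j ∈ S with w j = x, B j) =
      List.ofFn fun t : Fin v.length => ∑ j ∈ S with w j = v[t], B j by
    apply List.ext_getElem <;> simp, h]
  refine (Finset.sum_congr rfl fun g hg => ?_).trans
    (Finset.sum_subset (Finset.subset_univ _) fun g _ hg => ?_)
  · simp only [Fintype.mem_piFinset, Finset.mem_filter] at hg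
    rw [if_pos fun t => (hg t).2, if_pos fun t => (hg t).1, one_smul]
  · simp only [Fintype.mem_piFinset, Finset.mem_filter] at hg
    by_cases h1 : ∀ t, w (g t) = v[t]
    · have h2 : ¬ ∀ t, g t ∈ S := fun h2 => hg fun t => ⟨h2 t, h1 t⟩
      rw [if_pos h1, if_neg h2, zero_smul]
    · rw [if_neg h1]

/-- The multilinear part of a monomial, extracted by inclusion and exclusion. -/
theorem sum_prod_map_sum (v : List ℕ) {n : ℕ} (hv : v.length ≤ n) (w : Fin n → ℕ)
    (B : Fin n → R) :
    ∑ S : Finset (Fin n), (-1 : ℤ) ^ (Sᶜ).card •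
        (v.map fun x => ∑ j ∈ S with w j = x, B j).prod =
      ∑ σ : Equiv.Perm (Fin n), if v = List.ofFn (fun i => w (σ i)) then
        (List.ofFn fun i => B (σ i)).prod else 0 := by
  classical
  have h1 : ∑ S : Finset (Fin n), (-1 : ℤ) ^ (Sᶜ).card •
        (v.map fun x => ∑ j ∈ S with w j = x, B j).prod =
      ∑ g : Fin v.length → Fin n, if (∀ t, w (g t) = v[t]) ∧ Function.Surjective g then
        (List.ofFn fun t => B (g t)).prod else 0 := by
    simp only [prod_map_sum, Finset.smul_sum]
    rw [Finset.sum_comm]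
    refine Finset.sum_congr rfl fun g _ => ?_
    by_cases hg : ∀ t, w (g t) = v[t]
    · simp only [if_pos hg, smul_smul]
      rw [← Finset.sum_smul, sum_neg_one_pow_card_compl]
      by_cases hs : Function.Surjective g <;> simp [hg, hs]
    · simp only [hg, false_and, if_false, smul_zero, Finset.sum_const_zero]
  rw [h1]
  -- A word shorter than `n` admits no surjection onto `n` indices; at length `n` the surjections
  -- are the permutations.
  rcases hv.lt_or_eq with hlt | rfl
  · rw [Finset.sum_eq_zero, Finset.sum_eq_zero]
    · intro σ _
      refine if_neg fun h => ?_
      have := congrArg List.length h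
      simp at this
      omega
    · intro g _
      refine if_neg fun h => ?_
      have := Fintype.card_le_of_surjective g h.2
      simp at this
      omega
  · symm
    refine Finset.sum_of_injOn (fun σ => ⇑σ) (fun σ _ τ _ h => DFunLike.coe_injective h)
      (fun _ _ => Finset.mem_coe.2 (Finset.mem_univ _)) (fun g _ hg => if_neg fun h => ?_)
      fun σ _ => ?_
    · exact hg ⟨Equiv.ofBijective g ⟨Finite.injective_iff_surjective.2 h.2, h.2⟩,
        by simp, rfl⟩
    · refine if_congr ?_ rfl rfl
      simp only [σ.surjective, and_true]
      constructor
      · intro h t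
        have := congrArg (fun l => l[t.1]?) h
        simpa [eq_comm] using this
      · intro h
        apply List.ext_getElem
        · simp
        · intro i h1 h2
          simpa using (h ⟨i, h1⟩).symm

end Linearization

/-! ### From an admissible identity to a multilinear one. -/

section Identity

variable (k : Type*) {A : Type*} [CommRing k] [NonUnitalRing A] [Module k A]
  [IsScalarTower k A A] [SMulCommClass k A A]

theorem evalPoly_eq_sum (s : ℕ → A) (f : MonoidAlgebra k (FreeSemigroup ℕ)) :
    evalPoly k s f = ∑ v ∈ f.coeff.support, f.coeff v • evalWord s v := by
  simp [evalPoly, MonoidAlgebra.liftMagma, Finsupp.sum]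

/-- An admissible identity of degree `n` implies a multilinear identity of degree `n`, in which the
monomial `x₁ ⋯ xₙ` has coefficient `1`. -/
theorem exists_multilinear_identity {n : ℕ} {f : MonoidAlgebra k (FreeSemigroup ℕ)}
    (hf : IsPolynomialIdentity k A f) (hadm : IsAdmissible k f n) :
    ∃ c : Equiv.Perm (Fin n) → k, c 1 = 1 ∧ ∀ b : Fin n → A,
      ∑ σ, c σ • (List.ofFn fun i => (Unitization.inr (b (σ i)) : Unitization k A)).prod = 0 := by
  classical
  obtain ⟨hdeg, w₀, hw₀, hcoeff⟩ := hadm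
  let w : Fin n → ℕ := fun i => (letters w₀)[i.1]'(by rw [length_letters, hw₀]; exact i.2)
  refine ⟨fun σ => ∑ v ∈ f.coeff.support,
    if letters v = List.ofFn (fun i => w (σ i)) then f.coeff v else 0, ?_, fun b => ?_⟩
  · have h : ∀ v,
        letters v = List.ofFn (fun i => w ((1 : Equiv.Perm (Fin n)) i)) ↔ v = w₀ := fun v => by
      rw [← letters_injective.eq_iff, show List.ofFn (fun i => w ((1 : Equiv.Perm (Fin n)) i)) =
        letters w₀ from List.ext_getElem (by simp [length_letters, hw₀]) (by simp [w])]
    simp only [h, Finset.sum_ite_eq']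
    rw [← hcoeff, ite_eq_left_iff]
    exact fun h0 => (Finsupp.notMem_support_iff.1 h0).symm
  -- Each variable is replaced by the sum of the `b j` with `j ∈ S` at whose position it stands in
  -- `w₀`.
  · let s : Finset (Fin n) → ℕ → A := fun S x => ∑ j ∈ S with w j = x, b j
    have hs : ∀ S v, (Unitization.inr (evalWord (s S) v) : Unitization k A) =
        ((letters v).map fun x => ∑ j ∈ S with w j = x,
          (Unitization.inr (b j) : Unitization k A)).prod := fun S v => by
      rw [inr_evalWord]
      congr 2
      ext1 x
      exact map_sum (Unitization.inrHom k k A) _ _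
    have h0 : ∑ S : Finset (Fin n), (-1 : ℤ) ^ (Sᶜ).card •
        (Unitization.inr (evalPoly k (s S) f) : Unitization k A) = 0 := by
      refine Finset.sum_eq_zero fun S _ => ?_
      rw [hf, Unitization.inr_zero, smul_zero]
    have h1 : ∀ S, (Unitization.inr (evalPoly k (s S) f) : Unitization k A) =
        ∑ v ∈ f.coeff.support, f.coeff v • ((letters v).map fun x => ∑ j ∈ S with w j = x,
          (Unitization.inr (b j) : Unitization k A)).prod := fun S => by
      rw [evalPoly_eq_sum]
      refine (map_sum (Unitization.inrHom k k A) _ _).trans (Finset.sum_congr rfl fun v _ => ?_)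
      rw [map_smul, ← hs]
      rfl
    simp only [h1, Finset.smul_sum] at h0
    rw [Finset.sum_comm] at h0
    simp only [smul_comm _ (f.coeff _), ← Finset.smul_sum] at h0
    rw [Finset.sum_congr rfl fun v hv => by
      rw [sum_prod_map_sum _ (hdeg v (Finsupp.mem_support_iff.1 hv))]] at h0
    simp only [Finset.smul_sum] at h0
    rw [Finset.sum_comm] at h0
    rw [← h0]
    refine Finset.sum_congr rfl fun σ _ => ?_
    rw [Finset.sum_smul]
    refine Finset.sum_congr rfl fun v _ => ?_
    split_ifs <;> simp

end Identity
-- Rearranging blocks of a divisible word.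
section Lexicographic

variable {α : Type*}

theorem append_lt_append_of_length_eq [LinearOrder α] {a b : List α} (h : a < b)
    (hlen : a.length = b.length) (x y : List α) : a ++ x < b ++ y := by
  induction a generalizing b with
  | nil => simp_all [eq_comm, List.length_eq_zero_iff]
  | cons c a ih =>
    rcases b with _ | ⟨d, b⟩
    · simp at hlen
    rw [List.cons_append, List.cons_append, List.cons_lt_cons_iff]
    rcases List.cons_lt_cons_iff.1 h with h' | ⟨rfl, h'⟩
    · exact .inl h'
    · exact .inr ⟨rfl, ih h' (by simpa using hlen)⟩

theorem ofFn_id_lt_ofFn_perm {n : ℕ} {σ : Equiv.Perm (Fin n)} (hσ : σ ≠ 1) :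
    List.ofFn (id : Fin n → Fin n) < List.ofFn σ := by
  have hex : ∃ i, ∃ h : i < n, σ ⟨i, h⟩ ≠ ⟨i, h⟩ := by
    by_contra! hcon
    exact hσ (Equiv.ext fun i => hcon i i.2)
  classical
  obtain ⟨hi, hne⟩ := Nat.find_spec hex
  have hmin : ∀ j, (hj : j < Nat.find hex) → σ ⟨j, hj.trans hi⟩ = ⟨j, hj.trans hi⟩ :=
    fun j hj => by
      by_contra h
      exact Nat.find_min hex hj ⟨_, h⟩
  rw [List.lt_iff_exists]
  refine .inr ⟨Nat.find hex, by simpa using hi, by simpa using hi, fun j hj => ?_, ?_⟩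
  · simp [hmin j hj]
  · simp only [List.getElem_ofFn, id]
    -- At the first moved index all smaller values are already taken, so `σ` can only increase it.
    refine lt_of_le_of_ne ?_ (Ne.symm hne)
    by_contra! hlt
    have h1 := hmin _ (Fin.lt_def.1 hlt)
    exact hlt.ne (σ.injective h1)

/-- A nontrivial rearrangement of blocks whose beginnings strictly decrease is smaller. -/
theorem flatten_perm_lt [LinearOrder α] {n r : ℕ} {v : Fin n → List α}
    (hr : ∀ i, r ≤ (v i).length) (hv : ∀ i j, i < j → (v j).take r < (v i).take r)
    {σ : Equiv.Perm (Fin n)} (hσ : σ ≠ 1) :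
    (List.ofFn fun i => v (σ i)).flatten < (List.ofFn v).flatten := by
  have key : ∀ s t : List (Fin n), s.length = t.length → s < t →
      (t.map v).flatten < (s.map v).flatten := by
    intro s
    induction s with
    | nil => rintro (_ | ⟨j, t⟩) hlen h <;> simp at hlen h
    | cons i s ih =>
      rintro (_ | ⟨j, t⟩) hlen h
      · simp at hlen
      rw [List.map_cons, List.map_cons, List.flatten_cons, List.flatten_cons]
      rcases List.cons_lt_cons_iff.1 h with h' | ⟨rfl, h'⟩
      · rw [← List.take_append_drop r (v i), ← List.take_append_drop r (v j), List.append_assoc,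
          List.append_assoc]
        exact append_lt_append_of_length_eq (hv i j h') (by simp [hr]) _ _
      · exact List.append_left_lt (ih t (by simpa using hlen) h')
  have := key _ _ (by simp) (ofFn_id_lt_ofFn_perm hσ)
  simpa [List.map_ofFn, Function.comp_def] using this

theorem flatten_ofFn_fac (w : List α) (n : ℕ) (y : ℕ → ℕ) (hy : ∀ i < n, y i ≤ y (i + 1)) :
    (List.ofFn fun i : Fin n => fac w (y i) (y (i + 1) - y i)).flatten =
      fac w (y 0) (y n - y 0) ∧ y 0 ≤ y n := by
  induction n with
  | zero => simp [fac]
  | succ n ih =>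
    obtain ⟨h1, h2⟩ := ih fun i hi => hy i (by omega)
    have h3 := hy n (by omega)
    refine ⟨?_, h2.trans h3⟩
    rw [List.ofFn_succ', List.concat_eq_append, List.flatten_append]
    simp only [Fin.val_castSucc, Fin.val_last, List.flatten_singleton]
    rw [h1, show y (n + 1) - y 0 = (y n - y 0) + (y (n + 1) - y n) by omega, fac_add,
      Nat.add_sub_cancel' h2]

/-- A divisible word is a product of blocks whose beginnings strictly decrease. -/
theorem Divisible.exists_blocks [LT α] {n : ℕ} {w : List α} (h : Divisible n w) :
    ∃ (r : ℕ) (u : List α) (v : Fin n → List α), w = u ++ (List.ofFn v).flatten ∧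
      (∀ i, r ≤ (v i).length) ∧ ∀ i j, i < j → (v j).take r < (v i).take r := by
  obtain ⟨r, x, hx, hlt⟩ := h
  -- Each block runs up to the start of the next factor, the last one to the end of the word.
  let y : ℕ → ℕ := fun i => if i < n then x i else w.length
  have hyx : ∀ i < n, y i = x i := fun i hi => if_pos hi
  have hstep : ∀ i < n, y i + r ≤ y (i + 1) ∧ y (i + 1) ≤ w.length := by
    intro i hi
    rw [hyx i hi]
    by_cases hi' : i + 1 < n
    · rw [hyx _ hi']
      exact ⟨(hlt i (i + 1) (by omega) hi').1, by have := hx _ hi'; omega⟩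
    · simpa [y, hi'] using hx i hi
  obtain ⟨h1, h2⟩ := flatten_ofFn_fac w n y fun i hi => by have := (hstep i hi).1; omega
  have htake : ∀ i : Fin n, (fac w (y i) (y (i + 1) - y i)).take r = fac w (x i) r := fun i => by
    have := (hstep i i.2).1
    rw [fac, List.take_take, min_eq_left (by omega), hyx i i.2, fac]
  refine ⟨r, w.take (y 0), fun i => fac w (y i) (y (i + 1) - y i), ?_, fun i => ?_,
    fun i j hij => ?_⟩
  · rw [h1, ← take_eq_append_fac w h2]
    simp [y]
  · have := hstep i i.2
    rw [fac_length (by omega)]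
    omega
  · rw [htake, htake]
    exact (hlt i j hij j.2).2

end Lexicographic

/-! ### Reduction to indivisible words. -/

section Reduction

variable {k A : Type*} [CommRing k] [NonUnitalRing A] [Module k A]
  [IsScalarTower k A A] [SMulCommClass k A A]

variable (k) in
/-- The value of a list of letters in the unitization. -/
noncomputable def evalList {X : Type*} (a : X → A) (w : List X) : Unitization k A :=
  (w.map fun x => (Unitization.inr (a x) : Unitization k A)).prod

theorem evalList_letters {X : Type*} (a : X → A) (w : FreeSemigroup X) :
    evalList k a (letters w) = Unitization.inr (evalWord a w) :=
  (inr_evalWord a w).symm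

theorem evalList_append {X : Type*} (a : X → A) (v w : List X) :
    evalList k a (v ++ w) = evalList k a v * evalList k a w := by
  simp [evalList]

theorem evalList_flatten {X : Type*} (a : X → A) (L : List (List X)) :
    evalList k a L.flatten = (L.map (evalList k a)).prod := by
  induction L with
  | nil => simp [evalList]
  | cons w L ih => rw [List.flatten_cons, evalList_append, ih, List.map_cons, List.prod_cons]

/-- In an algebra with an identity of degree `n`, every divisible word is a linear combination of
smaller words of the same length. -/
theorem evalList_mem_span_of_divisible {X : Type*} [LinearOrder X] {n : ℕ} (hn : 2 ≤ n)
    {f : MonoidAlgebra k (FreeSemigroup ℕ)} (hf : IsPolynomialIdentity k A f)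
    (hadm : IsAdmissible k f n) (a : X → A) {w : List X} (hw : Divisible n w) :
    evalList k a w ∈
      Submodule.span k (evalList k a '' {v | v < w ∧ v.length = w.length}) := by
  obtain ⟨c, hc1, hc⟩ := exists_multilinear_identity k hf hadm
  obtain ⟨r, u, v, rfl, hr, hv⟩ := hw.exists_blocks
  have hne : ∀ i, v i ≠ [] := by
    rintro i hi
    have h0 : r = 0 := by simpa [hi] using hr i
    have := hv ⟨0, by omega⟩ ⟨1, by omega⟩ (Fin.mk_lt_mk.2 one_pos)
    simp [h0] at this
  choose b hb using fun i => exists_letters_eq (hne i)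
  have hsum : ∑ σ : Equiv.Perm (Fin n),
      c σ • evalList k a (u ++ (List.ofFn fun i => v (σ i)).flatten) = 0 := by
    have h := congrArg (fun z => evalList k a u * z) (hc fun i => evalWord a (b i))
    simp only [mul_zero, Finset.mul_sum, ← evalList_letters, hb] at h
    rw [← h]
    refine Finset.sum_congr rfl fun σ _ => ?_
    rw [evalList_append, evalList_flatten, List.map_ofFn, mul_smul_comm]
    rfl
  rw [← Finset.add_sum_erase _ _ (Finset.mem_univ 1), hc1, one_smul] at hsum
  rw [show (List.ofFn v) = List.ofFn fun i => v ((1 : Equiv.Perm (Fin n)) i) from rfl,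
    eq_neg_of_add_eq_zero_left hsum]
  refine Submodule.neg_mem _ (Submodule.sum_mem _ fun σ hσ => Submodule.smul_mem _ _
    (Submodule.subset_span ⟨_, ⟨List.append_left_lt (flatten_perm_lt hr hv
      (Finset.ne_of_mem_erase hσ)), ?_⟩, rfl⟩))
  simp only [List.length_append, List.length_flatten, List.map_ofFn, List.sum_ofFn,
    Function.comp_apply, Equiv.Perm.coe_one, id]
  rw [Equiv.sum_comp σ fun i => (v i).length]

/-- In an algebra with an identity of degree `n`, every word is a linear combination of indivisible
words of the same length. -/
theorem evalList_mem_span_not_divisible {X : Type*} [LinearOrder X] [Finite X] {n : ℕ}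
    (hn : 2 ≤ n) {f : MonoidAlgebra k (FreeSemigroup ℕ)} (hf : IsPolynomialIdentity k A f)
    (hadm : IsAdmissible k f n) (a : X → A) (w : List X) :
    evalList k a w ∈
      Submodule.span k (evalList k a '' {v | ¬ Divisible n v ∧ v.length = w.length}) := by
  -- Words of a fixed length over a finite alphabet are finite in number, which makes the
  -- lexicographic order well-founded on them.
  have hwf : {v : List X | v.length = w.length}.WellFoundedOn (· < ·) :=
    (List.finite_length_eq X w.length).wellFoundedOn
  refine hwf.induction (P := fun u => evalList k a u ∈
      Submodule.span k (evalList k a '' {v | ¬ Divisible n v ∧ v.length = w.length}))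
    (show w.length = w.length from rfl) fun u hu ih => ?_
  by_cases hdiv : Divisible n u
  · refine Submodule.span_le.2 ?_ (evalList_mem_span_of_divisible hn hf hadm a hdiv)
    rintro _ ⟨v, ⟨hvu, hlen⟩, rfl⟩
    exact ih v (hlen.trans hu) hvu
  · exact Submodule.subset_span ⟨u, ⟨hdiv, hu⟩, rfl⟩

theorem isProductOfPowers_of_isProductOfShortPowers {X : Type*} {n h : ℕ} {v : FreeSemigroup X}
    (hv : IsProductOfShortPowers n h (letters v)) :
    IsProductOfPowers {u : FreeSemigroup X | u.length < n} h v := by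
  obtain ⟨ps, hlen, hps, hprod⟩ := hv
  have key : ∃ p : List (FreeSemigroup X × ℕ), p.map (fun q => (letters q.1, q.2)) = ps := by
    clear hlen hprod
    induction ps with
    | nil => exact ⟨[], rfl⟩
    | cons q ps ih =>
      obtain ⟨p, rfl⟩ := ih fun q hq => hps q (List.mem_cons_of_mem _ hq)
      obtain ⟨u, hu⟩ := exists_letters_eq (hps q List.mem_cons_self).1
      exact ⟨(u, q.2) :: p, by simp [hu]⟩
  obtain ⟨p, rfl⟩ := key
  refine ⟨p, by simpa using hlen, fun q hq => ?_, FreeMonoid.toList.injective ?_⟩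
  · exact (hps _ (List.mem_map_of_mem hq)).2
  · rw [toList_toWord, hprod, FreeMonoid.toList_prod, List.map_map, List.map_map]
    congr 2
    ext1 q
    have : ∀ j : ℕ, FreeMonoid.toList (toWord q.1 ^ j) =
        (List.replicate j (letters q.1)).flatten := fun j => by
      induction j with
      | zero => rfl
      | succ j ih =>
        rw [pow_succ', FreeMonoid.toList_mul, ih, toList_toWord, List.replicate_succ,
          List.flatten_cons]
    exact (this q.2).symm

theorem heightAtMost_of_forall_not_divisible {X : Type*} [LinearOrder X] [Finite X] {n h : ℕ}
    (hn : 2 ≤ n) {f : MonoidAlgebra k (FreeSemigroup ℕ)} (hf : IsPolynomialIdentity k A f)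
    (hadm : IsAdmissible k f n) (a : X → A)
    (hX : ∀ w : List X, w ≠ [] → ¬ Divisible n w → IsProductOfShortPowers n h w) :
    HeightAtMost k a {u : FreeSemigroup X | u.length < n} h := by
  intro w
  have hw := evalList_mem_span_not_divisible hn hf hadm a (letters w)
  have hle : Submodule.span k (evalList k a '' {v | ¬ Divisible n v ∧
      v.length = (letters w).length}) ≤ (Submodule.span k (evalWord a ''
        {v | IsProductOfPowers {u : FreeSemigroup X | u.length < n} h v})).map
          (Unitization.inrHom k k A) := by
    rw [Submodule.map_span]
    refine Submodule.span_mono ?_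
    rintro _ ⟨v, ⟨hv, hlen⟩, rfl⟩
    have hne : v ≠ [] := by
      rintro rfl
      exact letters_ne_nil w (List.length_eq_zero_iff.1 hlen.symm)
    obtain ⟨v, rfl⟩ := exists_letters_eq hne
    exact ⟨_, ⟨v, isProductOfPowers_of_isProductOfShortPowers (hX _ hne hv), rfl⟩,
      (evalList_letters a v).symm⟩
  obtain ⟨y, hy, hyw⟩ := hle hw
  rw [evalList_letters] at hyw
  rwa [← Unitization.inr_injective (R := k) hyw]

end Reduction

/-! ### Numerical estimates. -/

section Bound

theorem seven_mul_logb_two_le {n : ℕ} (hn : 2 ≤ n) :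
    7 * Real.logb 2 n ≤ 12 * Real.logb 3 n := by
  have hlog : 0 ≤ Real.log n := Real.log_nonneg (by exact_mod_cast (by omega : 1 ≤ n))
  have h2 : 0 < Real.log 2 := Real.log_pos (by norm_num)
  have h3 : 0 < Real.log 3 := Real.log_pos (by norm_num)
  -- `3 ^ 7 = 2187 ≤ 4096 = 2 ^ 12`.
  have h : 7 * Real.log 3 ≤ 12 * Real.log 2 := by
    have : Real.log ((3 : ℝ) ^ 7) ≤ Real.log ((2 : ℝ) ^ 12) :=
      Real.log_le_log (by norm_num) (by norm_num)
    simpa [Real.log_pow] using this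
  rw [Real.logb, Real.logb, ← mul_div_assoc, ← mul_div_assoc, div_le_div_iff₀ h2 h3]
  nlinarith

theorem height_bound_le_Φ {n l : ℕ} (hn : 2 ≤ n) :
    (((2 * n + 1 + 2 ^ (Nat.log 2 n + 3)) * (2 ^ (Nat.log 2 n + 3) * n * l *
      (2 ^ (Nat.log 2 n + 3) * n ^ 3) ^ (Nat.log 2 n + 3) * n ^ 2) : ℕ) : ℝ) ≤ Φ n l := by
  have hn0 : n ≠ 0 := by omega
  have hJ : 2 ^ (Nat.log 2 n + 3) ≤ n ^ 4 := by
    have h1 : 2 ^ Nat.log 2 n ≤ n := Nat.pow_log_le_self 2 hn0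
    have h2 : 2 ^ 3 ≤ n ^ 3 := Nat.pow_le_pow_left hn 3
    calc 2 ^ (Nat.log 2 n + 3) = 2 ^ Nat.log 2 n * 2 ^ 3 := pow_add _ _ _
      _ ≤ n * n ^ 3 := Nat.mul_le_mul h1 h2
      _ = n ^ 4 := by ring
  have h5 : 2 * n + 1 + 2 ^ (Nat.log 2 n + 3) ≤ n ^ 5 := by
    have h2 : 2 ^ 3 ≤ n ^ 3 := Nat.pow_le_pow_left hn 3
    have h3 : n * 2 ^ 3 ≤ n * n ^ 3 := Nat.mul_le_mul_left n h2
    have h4 : 2 * n ^ 4 ≤ n * n ^ 4 := Nat.mul_le_mul_right _ hn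
    nlinarith
  have hnat : (2 * n + 1 + 2 ^ (Nat.log 2 n + 3)) * (2 ^ (Nat.log 2 n + 3) * n * l *
      (2 ^ (Nat.log 2 n + 3) * n ^ 3) ^ (Nat.log 2 n + 3) * n ^ 2) ≤
      l * n ^ (33 + 7 * Nat.log 2 n) := by
    calc _ ≤ n ^ 5 * (n ^ 4 * n * l * (n ^ 4 * n ^ 3) ^ (Nat.log 2 n + 3) * n ^ 2) := by
          gcongr
      _ = l * n ^ (33 + 7 * Nat.log 2 n) := by
          rw [← pow_add n 4 3, ← pow_mul]; ring
  have hn1 : (1 : ℝ) ≤ n := by exact_mod_cast (by omega : 1 ≤ n)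
  have hlog : (Nat.log 2 n : ℝ) ≤ Real.logb 2 n := by
    rw [Real.le_logb_iff_rpow_le (by norm_num) (by positivity), Real.rpow_natCast]
    exact_mod_cast Nat.pow_log_le_self 2 hn0
  have h34 : 1 ≤ Real.logb 3 4 := by
    rw [Real.le_logb_iff_rpow_le (by norm_num) (by norm_num)]
    norm_num
  -- As `log₃ 4 ≥ 1`, the constant `30 log₃ 4 + 10` is at least `40`, which exceeds `33`.
  have hexp : ((33 + 7 * Nat.log 2 n : ℕ) : ℝ) ≤
      (30 * Real.logb 3 4 + 10) + 12 * Real.logb 3 n := by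
    have := seven_mul_logb_two_le hn
    push_cast
    linarith
  calc _ ≤ ((l * n ^ (33 + 7 * Nat.log 2 n) : ℕ) : ℝ) := by exact_mod_cast hnat
    _ = 1 * (l : ℝ) * (n : ℝ) ^ ((33 + 7 * Nat.log 2 n : ℕ) : ℝ) := by
        rw [Real.rpow_natCast]; push_cast; ring
    _ ≤ Φ n l := by
        rw [Φ]
        gcongr
        exact Real.one_le_rpow (by norm_num) (by linarith)

end Bound

/-- An algebra with an admissible identity of degree one is zero. -/
theorem eq_zero_of_isAdmissible_one {k A : Type*} [CommRing k] [NonUnitalRing A] [Module k A]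
    [IsScalarTower k A A] [SMulCommClass k A A] {f : MonoidAlgebra k (FreeSemigroup ℕ)}
    (hf : IsPolynomialIdentity k A f) (hadm : IsAdmissible k f 1) (x : A) : x = 0 := by
  obtain ⟨c, hc1, hc⟩ := exists_multilinear_identity k hf hadm
  have h := hc fun _ => x
  rw [Fintype.sum_unique, show (default : Equiv.Perm (Fin 1)) = 1 from Subsingleton.elim _ _,
    hc1] at h
  exact Unitization.inr_injective (R := k) (by simpa using h)

theorem exists_hasHeight_le {k A X : Type*} [CommRing k] [NonUnitalRing A] [Module k A]
    {a : X → A} {Y : Set (FreeSemigroup X)} {h : ℕ} (hh : HeightAtMost k a Y h) :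
    ∃ m ≤ h, HasHeight k a Y m :=
  ⟨sInf {m | HeightAtMost k a Y m}, Nat.sInf_le hh, Nat.sInf_mem ⟨h, hh⟩,
    fun _ hm => Nat.sInf_le hm⟩

end ShirshovHeight

theorem mainTheorem7 {k A : Type*} [CommRing k] [NonUnitalRing A] [Module k A]
    [IsScalarTower k A A] [SMulCommClass k A A] (n l : ℕ)
    (a : Fin l → A) (ha : ShirshovHeight.Generates k a)
    (f : MonoidAlgebra k (FreeSemigroup ℕ))
    (hf : ShirshovHeight.IsPolynomialIdentity k A f)
    (hadm : ShirshovHeight.IsAdmissible k f n) :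
    ∃ h : ℕ, ShirshovHeight.HasHeight k a {u : FreeSemigroup (Fin l) | u.length < n} h ∧
      (h : ℝ) ≤ ShirshovHeight.Φ n l := by
  have hn : 1 ≤ n := by
    obtain ⟨-, w, rfl, -⟩ := hadm
    exact Nat.succ_le_succ (Nat.zero_le _)
  -- In degree one there are no short words, but `A` is zero and the height is `0`.
  rcases hn.eq_or_lt with rfl | hn
  · obtain ⟨m, hm, hm'⟩ := ShirshovHeight.exists_hasHeight_le (k := k) (a := a)
      (Y := {u : FreeSemigroup (Fin l) | u.length < 1}) (h := 0) fun w => by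
        rw [ShirshovHeight.eq_zero_of_isAdmissible_one hf hadm (ShirshovHeight.evalWord a w)]
        exact Submodule.zero_mem _
    refine ⟨m, hm', ?_⟩
    rw [Nat.le_zero.1 hm, Nat.cast_zero, ShirshovHeight.Φ]
    positivity
  -- `J = log₂ n + 3` gives `2 ^ J > 4 * n`: windows have room for factors of length `2 * n` at
  -- offsets below `n`.
  · have hJ : 3 * n ≤ 2 ^ (Nat.log 2 n + 3) := by
      have := Nat.lt_pow_succ_log_self one_lt_two n
      rw [pow_succ] at this
      rw [pow_add]
      omega
    obtain ⟨m, hm, hm'⟩ := ShirshovHeight.exists_hasHeight_le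
      (ShirshovHeight.heightAtMost_of_forall_not_divisible hn hf hadm a fun w hw hdiv => by
        obtain ⟨x, -⟩ := List.exists_mem_of_ne_nil w hw
        exact ShirshovHeight.isProductOfShortPowers_of_not_divisible
          (Fintype.card_pos_iff.2 ⟨x⟩) hn hJ hdiv)
    rw [Fintype.card_fin] at hm
    exact ⟨m, hm', (Nat.cast_le.2 hm).trans (ShirshovHeight.height_bound_le_Φ hn)⟩
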